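/- Let $d\ge 0$ be an integer and $\mu=(m_0,\dots,m_{2d-1})\in\mathbb{C}^{2d}$. Let $\tilde M_d=(m_{i+j})_{0\le i\le d-1,\;0\le j\le d}$ be the associated $d\times(d+1)$ Hankel matrix, let $r\le d$ be its rank, and let $|M_r|$ be its upper-left $r\times r$ minor (with $|M_0|=1$). The *Prony problem* of order $d$ with input $\mu$ asks for an integer $s\ge 0$, pairwise distinct nodes $x_1,\dots,x_s\in\mathbb{C}$, a multiplicity vector $D=(d_1,\dots,d_s)$ of positive integers of order $\sum_j d_j\le d$, and coefficients $a_{j,\ell}\in\mathbb{C}$ ($1\le j\le s$, $0\le \ell\le d_j-1$) with $a_{j,d_j-1}\ne 0$ for all $j$, such that $$\sum_{j=1}^{s}\sum_{\ell=0}^{d_j-1}\frac{k!}{(k-\ell)!}\,a_{j,\ell}\,x_j^{k-\ell}=m_k,\qquad k=0,1,\dots,2d-1,$$ where $k!/(k-\ell)!$ stands for $k(k-1)\cdots(k-\ell+1)$, so that terms with $\ell>k$ are zero. The *diagonal Padé problem* with input $\mu$ asks for a rational function $R=P/Q$ with $P,Q\in\mathbb{C}[z]$, $\deg P<\deg Q\le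 d$, such that $R(z)=\sum_{k=0}^{2d-1}m_k z^{-k-1}+O(z^{-2d-1})$ as $z\to\infty$. Then: 1. The Prony problem with input $\mu$ is solvable if and only if $|M_r|\neq 0$. 2. The solution, if it exists, is unique up to a permutation of the nodes $x_j$ (together with their multiplicities $d_j$ and coefficients $a_{j,\ell}$). 3. For every solution, $\sum_{j=1}^s d_j=r$; the rational function $$R_{D,X,A}(z)=\sum_{j=1}^{s}\sum_{\ell=1}^{d_j}(\ell-1)!\,\frac{a_{j,\ell-1}}{(z-x_j)^{\ell}}$$ is the unique solution of the Padé problem with input $\mu$; its poles are exactly $x_1,\dots,x_s$, and the multiplicity of the pole $x_j$ is $d_j$. -/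

import Mathlib

noncomputable section

namespace Prony

/-- The unknowns of a confluent Prony system: pairwise distinct nodes `x_j`, a multiplicity vector
`(d_1, …, d_s)` of positive integers, and coefficients `a_{j,ℓ}` for `0 ≤ ℓ < d_j` with
`a_{j,d_j-1} ≠ 0`. They describe a linear combination of shifted delta functions and their
derivatives. The case `s = 0` is the zero signal. -/
structure Signal where
  /-- the number of nodes -/
  s : ℕ
  /-- the nodes -/
  node : Fin s → ℂ
  node_injective : Function.Injective node
  /-- the multiplicity vector -/
  mult : Fin s → ℕ
  mult_pos : ∀ j, 0 < mult j
  /-- the coefficients -/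
  coeff : (j : Fin s) → Fin (mult j) → ℂ
  coeff_last_ne_zero : ∀ j, coeff j ⟨mult j - 1, Nat.sub_lt (mult_pos j) Nat.one_pos⟩ ≠ 0

namespace Signal

/-- The order of the multiplicity vector, which is the rank of the signal. -/
def order (F : Signal) : ℕ := ∑ j, F.mult j

/-- The left-hand side of the `k`-th confluent Prony equation,
`∑_j ∑_ℓ k!/(k-ℓ)! a_{j,ℓ} x_j^{k-ℓ}`. Here `k!/(k-ℓ)!` is the falling factorial
`k (k-1) ⋯ (k-ℓ+1)`, so the terms with `ℓ > k` vanish. -/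
def moment (F : Signal) (k : ℕ) : ℂ :=
  ∑ j, ∑ l : Fin (F.mult j),
    (k.descFactorial (l : ℕ) : ℂ) * F.coeff j l * F.node j ^ (k - (l : ℕ))

/-- The rational function `∑_j ∑_ℓ ℓ! a_{j,ℓ} / (z - x_j)^(ℓ+1)`, whose expansion at infinity is
`∑_k m_k z^(-k-1)`, with `m_k` the `k`-th moment as above. -/
def ratFunc (F : Signal) : RatFunc ℂ :=
  ∑ j, ∑ l : Fin (F.mult j),
    RatFunc.C (((l : ℕ).factorial : ℂ) * F.coeff j l) /
      (RatFunc.X - RatFunc.C (F.node j)) ^ ((l : ℕ) + 1)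

/-- Two signals agree up to a permutation of the nodes (the multiplicities and the coefficients are
permuted along with the nodes). -/
def EqUpToPerm (F G : Signal) : Prop :=
  ∃ e : Fin F.s ≃ Fin G.s, ∀ j,
    G.node (e j) = F.node j ∧ G.mult (e j) = F.mult j ∧
      ∀ (l : ℕ) (hF : l < F.mult j) (hG : l < G.mult (e j)),
        G.coeff (e j) ⟨l, hG⟩ = F.coeff j ⟨l, hF⟩

end Signal

/-- `F` solves the Prony problem of order `d` with right-hand side `(m_0, …, m_{2d-1})`. -/
def IsPronySolution {d : ℕ} (m : Fin (2 * d) → ℂ) (F : Signal) : Prop :=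
  F.order ≤ d ∧ ∀ k : Fin (2 * d), F.moment k = m k

/-- The `d × (d+1)` Hankel matrix `(m_{i+j})`, `0 ≤ i ≤ d-1`, `0 ≤ j ≤ d`. -/
def hankelMatrix {d : ℕ} (m : Fin (2 * d) → ℂ) : Matrix (Fin d) (Fin (d + 1)) ℂ :=
  Matrix.of fun i j => m ⟨(i : ℕ) + (j : ℕ), by omega⟩

/-- The upper-left `e × e` minor of the Hankel matrix (equal to `1` if `e = 0`). -/
def hankelMinor {d : ℕ} (m : Fin (2 * d) → ℂ) (e : ℕ) (he : e ≤ d) : ℂ :=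
  ((hankelMatrix m).submatrix (Fin.castLE he) (Fin.castLE (he.trans d.le_succ))).det

theorem hankelMatrix_rank_le {d : ℕ} (m : Fin (2 * d) → ℂ) : (hankelMatrix m).rank ≤ d :=
  (hankelMatrix m).rank_le_height

/-- The expansion at infinity of a rational function `R(z)`, as a Laurent series in `w = 1/z`. -/
def expansionAtInfty (R : RatFunc ℂ) : LaurentSeries ℂ :=
  R.eval (HahnSeries.C : ℂ →+* LaurentSeries ℂ) (HahnSeries.single (-1 : ℤ) (1 : ℂ))

/-- `R` solves the diagonal Padé problem: `R = P / Q` with `deg P < deg Q ≤ d`, and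
`R(z) = ∑_{k < 2d} m_k z^(-k-1) + O(z^(-2d-1))` at infinity. -/
def IsPadeSolution {d : ℕ} (m : Fin (2 * d) → ℂ) (R : RatFunc ℂ) : Prop :=
  (∃ P Q : Polynomial ℂ, P.degree < Q.degree ∧ Q.natDegree ≤ d ∧
    R = algebraMap (Polynomial ℂ) (RatFunc ℂ) P / algebraMap (Polynomial ℂ) (RatFunc ℂ) Q) ∧
  ∀ k : Fin (2 * d), (expansionAtInfty R).coeff ((k : ℤ) + 1) = m k

/-- The multiplicity of `z` as a pole of `R` (`0` if `z` is not a pole): the multiplicity of `z` as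
a root of the denominator of `R` in lowest terms. -/
def poleMultiplicity (R : RatFunc ℂ) (z : ℂ) : ℕ := R.denom.rootMultiplicity z

end Prony

end

/-! ### Expansion at infinity and uniqueness for the Padé problem -/

namespace Prony

open Polynomial

/-! With `w = 1/z`, expansion at infinity embeds `RatFunc ℂ` into Laurent series in `w`. The moments
of a signal are the coefficients of its rational function (`Signal.coeff_expansion_ratFunc`), so
Prony solutions are Padé solutions written in partial fractions. Uniqueness: for two Padé solutions
`P/Q` and `P'/Q'`, the polynomial `PQ' - P'Q` is `QQ'`, of degree at most `2d`, times a series in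
`O(w^(2d+1))`. It has only positive powers of `w`, hence is zero (`IsPadeSolution.unique`). Partial
fractions are unique as well (`partialFraction_injective`). Necessity: let `n` be the degree of the
reduced denominator `Q`. The recurrence given by `Q` bounds the rank by `n`, and a kernel vector of
the leading `n × n` block would give a nonzero multiple of `Q` of degree below `n`. So `n = r` and
`|M_r| ≠ 0` (`IsPronySolution.rank_eq`). Sufficiency: if `|M_r| ≠ 0`, inverting the block gives a
monic `Q` of degree `r` satisfying the first `r` recurrences. Rank considerations extend them to all
available indices (`exists_monic_of_hankelMinor_ne_zero`), and decomposing the resulting Padé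
solution gives a signal. -/

/-- The expansion at infinity of a polynomial, as a Laurent series in `w = 1/z`. -/
noncomputable def polyExpansion : ℂ[X] →+* LaurentSeries ℂ :=
  eval₂RingHom (HahnSeries.C : ℂ →+* LaurentSeries ℂ) (HahnSeries.single (-1 : ℤ) (1 : ℂ))

theorem polyExpansion_eq_sum (V : ℂ[X]) {n : ℕ} (hn : V.natDegree < n) :
    polyExpansion V =
      ∑ j ∈ Finset.range n, HahnSeries.single (-(j : ℤ)) (V.coeff j) := by
  rw [polyExpansion, coe_eval₂RingHom, eval₂_eq_sum_range' _ hn]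
  refine Finset.sum_congr rfl fun j _ => ?_
  rw [HahnSeries.single_pow, HahnSeries.C_apply, HahnSeries.single_mul_single]
  simp

theorem coeff_polyExpansion_mul (V : ℂ[X]) {n : ℕ} (hn : V.natDegree < n) (f : LaurentSeries ℂ)
    (e : ℤ) :
    (polyExpansion V * f).coeff e = ∑ j ∈ Finset.range n, V.coeff j * f.coeff (e + j) := by
  rw [polyExpansion_eq_sum V hn, Finset.sum_mul, HahnSeries.coeff_sum]
  refine Finset.sum_congr rfl fun j _ => ?_
  rw [HahnSeries.coeff_single_mul, sub_neg_eq_add]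

theorem coeff_polyExpansion (V : ℂ[X]) (e : ℤ) :
    (polyExpansion V).coeff e = if e ≤ 0 then V.coeff (-e).toNat else 0 := by
  rw [polyExpansion_eq_sum V (n := max V.natDegree (-e).toNat + 1) (by omega),
    HahnSeries.coeff_sum]
  split_ifs with he
  · rw [Finset.sum_eq_single (-e).toNat]
    · rw [HahnSeries.coeff_single, if_pos (by omega)]
    · intro j _ hj
      rw [HahnSeries.coeff_single, if_neg (by omega)]
    · intro h
      simp at h
  · refine Finset.sum_eq_zero fun j _ => ?_
    rw [HahnSeries.coeff_single, if_neg (by omega)]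

theorem polyExpansion_injective : Function.Injective polyExpansion := by
  rw [injective_iff_map_eq_zero]
  intro V hV
  ext n
  have := coeff_polyExpansion V (-(n : ℤ))
  simpa [hV] using this.symm

theorem polyExpansion_ne_zero {V : ℂ[X]} (hV : V ≠ 0) : polyExpansion V ≠ 0 :=
  (map_ne_zero_iff _ polyExpansion_injective).2 hV

theorem order_polyExpansion {V : ℂ[X]} (hV : V ≠ 0) :
    (polyExpansion V).order = -(V.natDegree : ℤ) := by
  apply le_antisymm
  · apply HahnSeries.order_le_of_coeff_ne_zero
    rw [coeff_polyExpansion, if_pos (by omega)]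
    simpa using hV
  · rw [HahnSeries.le_order_iff_forall (polyExpansion_ne_zero hV)]
    intro j hj
    rw [coeff_polyExpansion, if_pos (by omega)]
    exact coeff_eq_zero_of_natDegree_lt (by omega)

/-- `expansionAtInfty` as a ring homomorphism. -/
noncomputable def expansion : RatFunc ℂ →+* LaurentSeries ℂ :=
  RatFunc.liftRingHom polyExpansion
    (nonZeroDivisors_le_comap_nonZeroDivisors_of_injective _ polyExpansion_injective)

theorem expansionAtInfty_eq (R : RatFunc ℂ) : expansionAtInfty R = expansion R := by
  rw [expansion, RatFunc.liftRingHom_apply]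
  rfl

theorem expansion_algebraMap (V : ℂ[X]) :
    expansion (algebraMap ℂ[X] (RatFunc ℂ) V) = polyExpansion V :=
  RatFunc.liftRingHom_algebraMap _ _ _

theorem expansion_C (a : ℂ) : expansion (RatFunc.C a) = HahnSeries.C a := by
  rw [← RatFunc.algebraMap_C, expansion_algebraMap]
  simp [polyExpansion]

theorem order_mul_polyExpansion {f : LaurentSeries ℂ} (hf : f ≠ 0) {V : ℂ[X]} (hV : V ≠ 0) :
    (polyExpansion V * f).order = f.order - V.natDegree := by
  rw [HahnSeries.order_mul (polyExpansion_ne_zero hV) hf, order_polyExpansion hV]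
  ring

/-- Multiplying a series by a polynomial lowers its order by at most the degree. -/
theorem coeff_polyExpansion_mul_eq_zero {f : LaurentSeries ℂ} {N : ℤ}
    (hf : ∀ e < N, f.coeff e = 0) (V : ℂ[X]) {e : ℤ} (he : e < N - V.natDegree) :
    (polyExpansion V * f).coeff e = 0 := by
  rw [coeff_polyExpansion_mul V (Nat.lt_succ_self _)]
  refine Finset.sum_eq_zero fun j hj => ?_
  rw [hf _ (by simp at hj; omega), mul_zero]

/-- Orders add under multiplication and `V` has order `-deg V`, so cancelling `V` gains `deg V`
vanishing coefficients. -/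
theorem coeff_eq_zero_of_polyExpansion_mul {f : LaurentSeries ℂ} {V : ℂ[X]} (hV : V ≠ 0) {N : ℤ}
    (hf : ∀ e < N, (polyExpansion V * f).coeff e = 0) {e : ℤ} (he : e < N + V.natDegree) :
    f.coeff e = 0 := by
  rcases eq_or_ne f 0 with rfl | hf0
  · simp
  have h := (HahnSeries.le_order_iff_forall
    (mul_ne_zero (polyExpansion_ne_zero hV) hf0)).2 hf
  rw [order_mul_polyExpansion hf0 hV] at h
  exact HahnSeries.coeff_eq_zero_of_lt_order (by omega)

/-- A polynomial whose expansion has no polynomial part vanishes. -/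
theorem eq_zero_of_coeff_polyExpansion {V : ℂ[X]}
    (h : ∀ e ≤ (0 : ℤ), (polyExpansion V).coeff e = 0) : V = 0 := by
  ext n
  simpa [coeff_polyExpansion] using h (-(n : ℤ)) (by omega)

theorem polyExpansion_mul_expansion_div (P : ℂ[X]) {Q : ℂ[X]} (hQ : Q ≠ 0) :
    polyExpansion Q * expansion (algebraMap ℂ[X] (RatFunc ℂ) P / algebraMap ℂ[X] (RatFunc ℂ) Q) =
      polyExpansion P := by
  rw [← expansion_algebraMap, ← expansion_algebraMap, ← map_mul, mul_div_cancel₀]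
  simpa using hQ

theorem coeff_expansion_div_eq_zero {P Q : ℂ[X]} (h : P.degree < Q.degree) {e : ℤ} (he : e ≤ 0) :
    (expansion (algebraMap ℂ[X] (RatFunc ℂ) P / algebraMap ℂ[X] (RatFunc ℂ) Q)).coeff e = 0 := by
  have hQ : Q ≠ 0 := by rintro rfl; simp at h
  refine coeff_eq_zero_of_polyExpansion_mul hQ (N := 1 - Q.natDegree) (fun i hi => ?_) (by omega)
  rw [polyExpansion_mul_expansion_div P hQ, coeff_polyExpansion]
  split_ifs with h0
  · apply coeff_eq_zero_of_degree_lt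
    refine h.trans_le ?_
    rw [degree_eq_natDegree hQ]
    exact_mod_cast (by omega : Q.natDegree ≤ (-i).toNat)
  · rfl

/-- Since `z - x = w⁻¹ (1 - x w)`, this is the negative binomial series rescaled by `x`. -/
theorem expansion_inv_X_sub_C_pow (x : ℂ) (l : ℕ) :
    expansion (((RatFunc.X - RatFunc.C x) ^ (l + 1))⁻¹) =
      HahnSeries.single ((l : ℤ) + 1) 1 * HahnSeries.ofPowerSeries ℤ ℂ
        (PowerSeries.mk fun n => x ^ n * (Nat.choose (l + n) l : ℂ)) := by
  have h1 : expansion (RatFunc.X - RatFunc.C x) =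
      HahnSeries.single (-1 : ℤ) 1 *
        HahnSeries.ofPowerSeries ℤ ℂ (PowerSeries.rescale x (1 - PowerSeries.X)) := by
    rw [map_sub, expansion_C, ← RatFunc.algebraMap_X, expansion_algebraMap]
    simp only [polyExpansion, coe_eval₂RingHom, eval₂_X, map_sub, map_one, mul_sub, mul_one,
      PowerSeries.rescale_X, map_mul, HahnSeries.ofPowerSeries_C, HahnSeries.ofPowerSeries_X]
    rw [mul_left_comm, HahnSeries.single_mul_single]
    simp
  rw [map_inv₀, map_pow, h1]
  apply inv_eq_of_mul_eq_one_left
  have h2 := congrArg (fun f => HahnSeries.ofPowerSeries ℤ ℂ (PowerSeries.rescale x f))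
    (PowerSeries.mk_add_choose_mul_one_sub_pow_eq_one ℂ (d := l))
  simp only [map_mul, map_pow, map_one, PowerSeries.rescale_mk] at h2
  rw [mul_pow, mul_mul_mul_comm, HahnSeries.single_pow, HahnSeries.single_mul_single, h2]
  simp

theorem coeff_expansion_inv_X_sub_C_pow (x : ℂ) (l k : ℕ) :
    (expansion (((RatFunc.X - RatFunc.C x) ^ (l + 1))⁻¹)).coeff ((k : ℤ) + 1) =
      (Nat.choose k l : ℂ) * x ^ (k - l) := by
  rw [expansion_inv_X_sub_C_pow, HahnSeries.coeff_single_mul, one_mul]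
  by_cases h : l ≤ k
  · obtain ⟨n, rfl⟩ := Nat.exists_eq_add_of_le h
    have : ((l + n : ℕ) : ℤ) + 1 - (l + 1) = (n : ℤ) := by push_cast; ring
    rw [this, HahnSeries.ofPowerSeries_apply_coeff, PowerSeries.coeff_mk, mul_comm]
    simp
  -- For `l > k` the power series is read at the negative index `k - l`; on the other side `x ^ (k -
  -- l)` is truncated to `1`, but the binomial vanishes.
  · rw [Nat.choose_eq_zero_of_lt (by omega)]
    rw [PowerSeries.coeff_coe, if_pos (by omega)]
    simp

theorem Signal.coeff_expansion_ratFunc (F : Signal) (k : ℕ) :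
    (expansion F.ratFunc).coeff ((k : ℤ) + 1) = F.moment k := by
  simp only [Signal.ratFunc, Signal.moment, map_sum, HahnSeries.coeff_sum]
  refine Finset.sum_congr rfl fun j _ => Finset.sum_congr rfl fun l _ => ?_
  rw [div_eq_mul_inv, map_mul, expansion_C, HahnSeries.C_mul_eq_smul, HahnSeries.coeff_smul,
    coeff_expansion_inv_X_sub_C_pow, Nat.descFactorial_eq_factorial_mul_choose, smul_eq_mul]
  push_cast
  ring

/-- The diagonal Padé problem has at most one solution. -/
theorem IsPadeSolution.unique {d : ℕ} {m : Fin (2 * d) → ℂ} {R S : RatFunc ℂ}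
    (hR : IsPadeSolution m R) (hS : IsPadeSolution m S) : R = S := by
  obtain ⟨⟨P, Q, hPQ, hQd, rfl⟩, hR⟩ := hR
  obtain ⟨⟨P', Q', hPQ', hQd', rfl⟩, hS⟩ := hS
  have hQ : Q ≠ 0 := by rintro rfl; simp at hPQ
  have hQ' : Q' ≠ 0 := by rintro rfl; simp at hPQ'
  have h : P * Q' - P' * Q = 0 := by
    apply eq_zero_of_coeff_polyExpansion
    intro e he
    have : polyExpansion (P * Q' - P' * Q) = polyExpansion (Q * Q') *
        (expansion (algebraMap ℂ[X] (RatFunc ℂ) P / algebraMap ℂ[X] (RatFunc ℂ) Q) -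
          expansion (algebraMap ℂ[X] (RatFunc ℂ) P' / algebraMap ℂ[X] (RatFunc ℂ) Q')) := by
      rw [map_sub, map_mul, map_mul, ← polyExpansion_mul_expansion_div P hQ,
        ← polyExpansion_mul_expansion_div P' hQ', map_mul]
      ring
    rw [this]
    -- The `2d` matched moments exactly offset `deg (Q * Q') ≤ 2d`.
    refine coeff_polyExpansion_mul_eq_zero (N := 2 * d + 1) (fun i hi => ?_) _ ?_
    · rw [HahnSeries.coeff_sub]
      rcases le_or_gt i 0 with h0 | h0
      · rw [coeff_expansion_div_eq_zero hPQ h0, coeff_expansion_div_eq_zero hPQ' h0, sub_zero]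
      · obtain ⟨k, rfl⟩ : ∃ k : ℕ, i = (k : ℤ) + 1 := ⟨(i - 1).toNat, by omega⟩
        have hk : k < 2 * d := by omega
        rw [← expansionAtInfty_eq, ← expansionAtInfty_eq]
        exact sub_eq_zero.2 ((hR ⟨k, hk⟩).trans (hS ⟨k, hk⟩).symm)
    · rw [natDegree_mul hQ hQ']
      push_cast
      omega
  rw [div_eq_div_iff (by simpa using hQ) (by simpa using hQ'), ← map_mul, ← map_mul,
    sub_eq_zero.1 h]

end Prony

/-! ### Signals: reduced fraction, poles, and encoding by finitely supported polynomials -/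

namespace Prony

open Polynomial

namespace Signal

variable (F : Signal)

/-- The polynomial `∑_l l! a_{j,l} T^l` collecting the coefficients at the `j`-th node. -/
noncomputable def coeffPoly (j : Fin F.s) : ℂ[X] :=
  ∑ l : Fin (F.mult j), monomial (l : ℕ) (((l : ℕ).factorial : ℂ) * F.coeff j l)

/-- The numerator of the principal part at the `j`-th node over `(X - x_j) ^ d_j`. -/
noncomputable def localNum (j : Fin F.s) : ℂ[X] :=
  ∑ l : Fin (F.mult j),
    C (((l : ℕ).factorial : ℂ) * F.coeff j l) * (X - C (F.node j)) ^ (F.mult j - 1 - (l : ℕ))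

/-- The product of `(X - x_i) ^ d_i` over the nodes other than the `j`-th one. -/
noncomputable def cofactor (j : Fin F.s) : ℂ[X] :=
  ∏ i ∈ Finset.univ.erase j, (X - C (F.node i)) ^ F.mult i

/-- The denominator `∏_j (X - x_j) ^ d_j` of the rational function of a signal. -/
noncomputable def den : ℂ[X] := ∏ j, (X - C (F.node j)) ^ F.mult j

/-- The numerator of the rational function of a signal over `den`. -/
noncomputable def num : ℂ[X] := ∑ j, F.localNum j * F.cofactor j

theorem den_monic : F.den.Monic :=
  monic_prod_of_monic _ _ fun _ _ => (monic_X_sub_C _).pow _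

theorem natDegree_den : F.den.natDegree = F.order := by
  rw [den, natDegree_prod_of_monic _ _ fun _ _ => (monic_X_sub_C _).pow _, order]
  simp

theorem pow_mul_cofactor (j : Fin F.s) :
    (X - C (F.node j)) ^ F.mult j * F.cofactor j = F.den :=
  Finset.mul_prod_erase Finset.univ (fun i => (X - C (F.node i)) ^ F.mult i) (Finset.mem_univ j)

theorem degree_localNum_lt (j : Fin F.s) : (F.localNum j).degree < F.mult j := by
  refine (degree_sum_le _ _).trans_lt ((Finset.sup_lt_iff (WithBot.bot_lt_coe _)).2 fun l _ => ?_)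
  rw [← smul_eq_C_mul]
  refine (degree_smul_le _ _).trans_lt ?_
  rw [degree_pow, degree_X_sub_C, nsmul_one]
  have := F.mult_pos j
  exact_mod_cast (by omega : F.mult j - 1 - (l : ℕ) < F.mult j)

theorem degree_num_lt : F.num.degree < F.den.degree := by
  refine (degree_sum_le _ _).trans_lt ((Finset.sup_lt_iff ?_).2 fun j _ => ?_)
  · exact bot_lt_iff_ne_bot.2 (degree_ne_bot.2 F.den_monic.ne_zero)
  · have hc : F.cofactor j ≠ 0 := right_ne_zero_of_mul
      (F.pow_mul_cofactor j ▸ F.den_monic.ne_zero)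
    rw [← F.pow_mul_cofactor j, degree_mul, degree_mul, degree_pow, degree_X_sub_C, nsmul_one]
    exact WithBot.add_lt_add_right (degree_ne_bot.2 hc) (F.degree_localNum_lt j)

/-- Only the term `l = d_j - 1` survives at the node, and its coefficient is nonzero by
`coeff_last_ne_zero`. -/
theorem eval_localNum (j : Fin F.s) : (F.localNum j).eval (F.node j) ≠ 0 := by
  have hpos := F.mult_pos j
  rw [localNum, eval_finsetSum,
    Finset.sum_eq_single ⟨F.mult j - 1, Nat.sub_lt hpos Nat.one_pos⟩]
  · simpa using ⟨Nat.factorial_ne_zero _, F.coeff_last_ne_zero j⟩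
  · intro l _ hl
    have : F.mult j - 1 - (l : ℕ) ≠ 0 := by
      have := l.2
      have : (l : ℕ) ≠ F.mult j - 1 := fun h => hl (Fin.ext h)
      omega
    simp [this]
  · simp

theorem eval_num (j : Fin F.s) : F.num.eval (F.node j) ≠ 0 := by
  rw [num, eval_finsetSum, Finset.sum_eq_single j]
  · rw [eval_mul]
    refine mul_ne_zero (F.eval_localNum j) ?_
    rw [cofactor, eval_prod, Finset.prod_ne_zero_iff]
    intro i hi
    rw [eval_pow, eval_sub, eval_X, eval_C]
    exact pow_ne_zero _ (sub_ne_zero.2 fun h =>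
      (Finset.mem_erase.1 hi).1 (F.node_injective h).symm)
  · intro i _ hij
    rw [eval_mul, cofactor, eval_prod, Finset.prod_eq_zero (i := j)]
    · simp
    · simpa using hij.symm
    · simp [(F.mult_pos j).ne']
  · simp

/-- This puts `num / den` in lowest terms, so the poles and their multiplicities can be read off
`den`. -/
theorem isCoprime_num_den : IsCoprime F.num F.den := by
  refine IsCoprime.prod_right fun j _ => IsCoprime.pow_right (IsCoprime.symm ?_)
  rw [(irreducible_X_sub_C _).coprime_iff_not_dvd, dvd_iff_isRoot]
  exact F.eval_num j

theorem ratFunc_eq : F.ratFunc =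
    algebraMap ℂ[X] (RatFunc ℂ) F.num / algebraMap ℂ[X] (RatFunc ℂ) F.den := by
  have hX : ∀ j, (RatFunc.X - RatFunc.C (F.node j) : RatFunc ℂ) ≠ 0 := fun j => by
    rw [← RatFunc.algebraMap_X, ← RatFunc.algebraMap_C, ← map_sub]
    exact RatFunc.algebraMap_ne_zero (X_sub_C_ne_zero _)
  have hden : algebraMap ℂ[X] (RatFunc ℂ) F.den ≠ 0 := by simpa using F.den_monic.ne_zero
  rw [eq_div_iff hden, ratFunc, num, map_sum, Finset.sum_mul]
  refine Finset.sum_congr rfl fun j _ => ?_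
  rw [← F.pow_mul_cofactor j, localNum, map_mul, map_mul, ← mul_assoc, Finset.sum_mul, map_sum]
  congr 1
  refine Finset.sum_congr rfl fun l _ => ?_
  simp only [map_mul, map_pow, map_sub, RatFunc.algebraMap_X, RatFunc.algebraMap_C]
  rw [div_mul_eq_mul_div, div_eq_iff (pow_ne_zero _ (hX j)), mul_assoc _ _ (_ ^ ((l : ℕ) + 1)),
    ← pow_add, show F.mult j - 1 - (l : ℕ) + (l + 1) = F.mult j by omega]

theorem denom_ratFunc : F.ratFunc.denom = F.den := by
  refine eq_of_monic_of_associated (RatFunc.monic_denom _) F.den_monic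
    (associated_of_dvd_dvd ?_ ?_)
  · rw [ratFunc_eq]
    exact RatFunc.denom_div_dvd _ _
  · refine F.isCoprime_num_den.symm.dvd_of_dvd_mul_left (Dvd.intro_left F.ratFunc.num ?_)
    rw [RatFunc.num_mul_eq_mul_denom_iff F.den_monic.ne_zero]
    exact F.ratFunc_eq

theorem poleMultiplicity_eq (z : ℂ) :
    poleMultiplicity F.ratFunc z = ∑ j, if F.node j = z then F.mult j else 0 := by
  classical
  rw [poleMultiplicity, denom_ratFunc, ← count_roots, den, roots_prod _ _ F.den_monic.ne_zero,
    Multiset.count_bind]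
  simp [Multiset.count_nsmul, Multiset.count_singleton, List.sum_ofFn, eq_comm]

theorem poleMultiplicity_node (j : Fin F.s) :
    poleMultiplicity F.ratFunc (F.node j) = F.mult j := by
  rw [poleMultiplicity_eq, Finset.sum_eq_single j]
  · simp
  · intro i _ hij
    rw [if_neg fun h => hij (F.node_injective h)]
  · simp

theorem poleMultiplicity_pos_iff (z : ℂ) :
    0 < poleMultiplicity F.ratFunc z ↔ ∃ j, F.node j = z := by
  constructor
  · intro h
    by_contra! hz
    rw [poleMultiplicity_eq, Finset.sum_eq_zero fun j _ => if_neg (hz j)] at h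
    exact h.false
  · rintro ⟨j, rfl⟩
    rw [poleMultiplicity_node]
    exact F.mult_pos j

theorem coeff_coeffPoly (j : Fin F.s) {l : ℕ} (hl : l < F.mult j) :
    (F.coeffPoly j).coeff l = (l.factorial : ℂ) * F.coeff j ⟨l, hl⟩ := by
  rw [coeffPoly, finsetSum_coeff, Finset.sum_eq_single ⟨l, hl⟩]
  · simp
  · intro i _ hi
    rw [coeff_monomial, if_neg fun h => hi (Fin.ext h)]
  · simp

theorem coeff_coeffPoly_of_le (j : Fin F.s) {l : ℕ} (hl : F.mult j ≤ l) :
    (F.coeffPoly j).coeff l = 0 := by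
  rw [coeffPoly, finsetSum_coeff]
  refine Finset.sum_eq_zero fun i _ => ?_
  rw [coeff_monomial, if_neg (by omega)]

theorem coeff_coeffPoly_last (j : Fin F.s) : (F.coeffPoly j).coeff (F.mult j - 1) ≠ 0 := by
  rw [F.coeff_coeffPoly j (Nat.sub_lt (F.mult_pos j) Nat.one_pos)]
  exact mul_ne_zero (by exact_mod_cast Nat.factorial_ne_zero _) (F.coeff_last_ne_zero j)

/-- The nonvanishing last coefficient makes the multiplicity recoverable from the polynomial; hence
`toFinsupp` loses only the ordering of the nodes. -/
theorem natDegree_coeffPoly (j : Fin F.s) : (F.coeffPoly j).natDegree + 1 = F.mult j := by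
  have hpos := F.mult_pos j
  have h1 := le_natDegree_of_ne_zero (F.coeff_coeffPoly_last j)
  have h2 : (F.coeffPoly j).natDegree ≤ F.mult j - 1 := natDegree_le_iff_coeff_eq_zero.2
    fun n hn => F.coeff_coeffPoly_of_le j (by omega)
  omega

/-- The coefficients of a signal as a finitely supported family of polynomials. -/
noncomputable def toFinsupp : ℂ →₀ ℂ[X] := ∑ j, Finsupp.single (F.node j) (F.coeffPoly j)

theorem toFinsupp_node (j : Fin F.s) : F.toFinsupp (F.node j) = F.coeffPoly j := by
  rw [toFinsupp, Finsupp.finsetSum_apply, Finset.sum_eq_single j]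
  · simp
  · intro i _ hij
    rw [Finsupp.single_apply, if_neg fun h => hij (F.node_injective h)]
  · simp

theorem exists_node_of_toFinsupp_ne_zero {z : ℂ} (hz : F.toFinsupp z ≠ 0) :
    ∃ j, F.node j = z := by
  by_contra! h
  refine hz ?_
  rw [toFinsupp, Finsupp.finsetSum_apply]
  exact Finset.sum_eq_zero fun j _ => by rw [Finsupp.single_apply, if_neg (h j)]

theorem toFinsupp_node_ne_zero (j : Fin F.s) : F.toFinsupp (F.node j) ≠ 0 := by
  rw [toFinsupp_node]
  intro h
  exact F.coeff_coeffPoly_last j (by rw [h, coeff_zero])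

theorem EqUpToPerm.of_toFinsupp_eq {F G : Signal} (h : F.toFinsupp = G.toFinsupp) :
    F.EqUpToPerm G := by
  have key : ∀ j, ∃ i, G.node i = F.node j := fun j =>
    G.exists_node_of_toFinsupp_ne_zero (h ▸ F.toFinsupp_node_ne_zero j)
  choose e he using key
  have hbij : Function.Bijective e := by
    refine ⟨fun i j hij => F.node_injective ?_, fun i => ?_⟩
    · rw [← he, ← he, hij]
    · obtain ⟨j, hj⟩ := F.exists_node_of_toFinsupp_ne_zero (h ▸ G.toFinsupp_node_ne_zero i)
      exact ⟨j, G.node_injective ((he j).trans hj)⟩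
  have hpoly : ∀ j, G.coeffPoly (e j) = F.coeffPoly j := fun j => by
    rw [← toFinsupp_node, ← toFinsupp_node, he, h]
  refine ⟨Equiv.ofBijective e hbij, fun j => ⟨he j, ?_, fun l hF hG => ?_⟩⟩
  · rw [Equiv.ofBijective_apply, ← natDegree_coeffPoly, hpoly, natDegree_coeffPoly]
  · have hc := congrArg (fun p => p.coeff l) (hpoly j)
    simp only [F.coeff_coeffPoly j hF, G.coeff_coeffPoly (e j) hG] at hc
    exact mul_left_cancel₀ (by exact_mod_cast Nat.factorial_ne_zero l) hc

/-- The signal with prescribed coefficients. -/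
noncomputable def ofFinsupp (c : ℂ →₀ ℂ[X]) : Signal where
  s := c.support.card
  node i := c.support.equivFin.symm i
  node_injective := Subtype.val_injective.comp c.support.equivFin.symm.injective
  mult i := (c (c.support.equivFin.symm i)).natDegree + 1
  mult_pos _ := Nat.succ_pos _
  coeff i l := (c (c.support.equivFin.symm i)).coeff l / ((l : ℕ).factorial : ℂ)
  coeff_last_ne_zero i := by
    refine div_ne_zero ?_ (by exact_mod_cast Nat.factorial_ne_zero _)
    simpa using Finsupp.mem_support_iff.1 (c.support.equivFin.symm i).2

theorem coeffPoly_ofFinsupp (c : ℂ →₀ ℂ[X]) (i : Fin (ofFinsupp c).s) :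
    (ofFinsupp c).coeffPoly i = c ((ofFinsupp c).node i) := by
  have h : ∀ l : ℕ, (l.factorial : ℂ) ≠ 0 := fun l => by exact_mod_cast Nat.factorial_ne_zero l
  simp only [coeffPoly, ofFinsupp, mul_div_cancel₀ _ (h _)]
  exact (Fin.sum_univ_eq_sum_range (fun l => monomial l ((c (c.support.equivFin.symm i)).coeff l))
    _).trans (as_sum_range _).symm

theorem toFinsupp_ofFinsupp (c : ℂ →₀ ℂ[X]) : (ofFinsupp c).toFinsupp = c := by
  simp only [toFinsupp, coeffPoly_ofFinsupp]
  refine (Equiv.sum_comp c.support.equivFin.symm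
    (fun z : c.support => Finsupp.single (z : ℂ) (c z))).trans ?_
  rw [Finset.sum_coe_sort c.support (fun z => Finsupp.single z (c z))]
  exact c.sum_single

end Signal

/-! ### Existence and uniqueness of partial fractions -/

/-- The rational function `∑_x ∑_l c_{x,l} / (X - x) ^ (l + 1)`. -/
noncomputable def partialFraction : (ℂ →₀ ℂ[X]) →+ RatFunc ℂ :=
  Finsupp.liftAddHom fun x =>
    (AddMonoidHom.mulLeft (RatFunc.X - RatFunc.C x)⁻¹).comp
      (eval₂RingHom RatFunc.C (RatFunc.X - RatFunc.C x)⁻¹).toAddMonoidHom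

theorem partialFraction_single (x : ℂ) (p : ℂ[X]) :
    partialFraction (Finsupp.single x p) =
      (RatFunc.X - RatFunc.C x)⁻¹ * p.eval₂ RatFunc.C (RatFunc.X - RatFunc.C x)⁻¹ := by
  simp [partialFraction]

theorem partialFraction_single_monomial (x : ℂ) (l : ℕ) (a : ℂ) :
    partialFraction (Finsupp.single x (monomial l a)) =
      RatFunc.C a / (RatFunc.X - RatFunc.C x) ^ (l + 1) := by
  rw [partialFraction_single, eval₂_monomial, div_eq_mul_inv, ← inv_pow, pow_succ]
  ring

theorem Signal.partialFraction_toFinsupp (F : Signal) :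
    partialFraction F.toFinsupp = F.ratFunc := by
  rw [Signal.toFinsupp, map_sum, Signal.ratFunc]
  refine Finset.sum_congr rfl fun j _ => ?_
  rw [Signal.coeffPoly, Finsupp.single_finsetSum, map_sum]
  exact Finset.sum_congr rfl fun l _ => partialFraction_single_monomial _ _ _

/-- A nonzero family comes from a signal with at least one node, where its rational function has a
pole; the zero function has none. -/
theorem partialFraction_injective : Function.Injective partialFraction := by
  rw [injective_iff_map_eq_zero]
  intro c hc
  rw [← Signal.toFinsupp_ofFinsupp c, Signal.partialFraction_toFinsupp] at hc
  by_contra hne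
  obtain ⟨z, hz⟩ := DFunLike.ne_iff.1 hne
  rw [← Signal.toFinsupp_ofFinsupp c] at hz
  obtain ⟨j, -⟩ := (Signal.ofFinsupp c).exists_node_of_toFinsupp_ne_zero hz
  have h := (Signal.ofFinsupp c).poleMultiplicity_node j
  rw [hc, poleMultiplicity, RatFunc.denom_zero, ← C_1, rootMultiplicity_C] at h
  exact ((Signal.ofFinsupp c).mult_pos j).ne h

theorem Signal.EqUpToPerm.of_ratFunc_eq {F G : Signal} (h : F.ratFunc = G.ratFunc) :
    F.EqUpToPerm G := by
  rw [← partialFraction_toFinsupp, ← partialFraction_toFinsupp] at h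
  exact .of_toFinsupp_eq (partialFraction_injective h)

/-- Induction on the degree of the denominator, lowering the order of one pole by one at each step.
-/
theorem exists_partialFraction_eq (n : ℕ) : ∀ P Q : ℂ[X], P.degree < Q.degree →
    Q.natDegree = n → ∃ c, partialFraction c =
      algebraMap ℂ[X] (RatFunc ℂ) P / algebraMap ℂ[X] (RatFunc ℂ) Q := by
  induction n with
  | zero =>
    intro P Q hPQ hQ
    have hP : P = 0 := by
      rw [← degree_eq_bot, ← Nat.WithBot.lt_zero_iff]
      exact hPQ.trans_le (natDegree_eq_zero_iff_degree_le_zero.1 hQ)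
    exact ⟨0, by simp [hP]⟩
  | succ n ih =>
    intro P Q hPQ hQ
    have hQ0 : Q ≠ 0 := by rintro rfl; simp at hQ
    obtain ⟨x, hx⟩ := IsAlgClosed.exists_root Q (by
      rw [degree_eq_natDegree hQ0, hQ]
      exact_mod_cast n.succ_ne_zero)
    obtain ⟨Q', hQ', hdvd⟩ := exists_eq_pow_rootMultiplicity_mul_and_not_dvd Q hQ0 x
    obtain ⟨k, hk⟩ := Nat.exists_eq_succ_of_ne_zero ((rootMultiplicity_pos hQ0).2 hx).ne'
    rw [hk] at hQ'
    have hev : Q'.eval x ≠ 0 := fun h => hdvd (dvd_iff_isRoot.2 h)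
    have hQ'0 : Q' ≠ 0 := by rintro rfl; simp at hev
    -- With `Q = (X - x)^(k+1) Q'`, subtracting `a / (X - x)^(k+1)` for `a = P(x) / Q'(x)` makes the
    -- numerator vanish at `x`, so one factor cancels.
    obtain ⟨P₁, hP₁⟩ : X - C x ∣ P - C (P.eval x / Q'.eval x) * Q' := by
      rw [dvd_iff_isRoot]
      simp [hev]
    have hX := X_sub_C_ne_zero x
    have hfac : Q = (X - C x) * ((X - C x) ^ k * Q') := by
      rw [hQ', pow_succ]; ring
    have hne : (X - C x) ^ k * Q' ≠ 0 := mul_ne_zero (pow_ne_zero _ hX) hQ'0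
    have hdeg : P₁.degree < ((X - C x) ^ k * Q').degree := by
      have h1 : ((X - C x) * P₁).degree < ((X - C x) * ((X - C x) ^ k * Q')).degree := by
        rw [← hP₁, ← hfac]
        refine (degree_sub_le _ _).trans_lt (max_lt hPQ ?_)
        rw [← smul_eq_C_mul]
        refine (degree_smul_le _ _).trans_lt ?_
        rw [hQ', degree_mul, degree_pow, degree_X_sub_C, degree_eq_natDegree hQ'0, nsmul_one]
        exact_mod_cast (by omega : Q'.natDegree < k.succ + Q'.natDegree)
      rw [degree_mul, degree_mul] at h1
      exact lt_of_add_lt_add_left h1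
    obtain ⟨c, hc⟩ := ih P₁ _ hdeg (by
      rw [hfac, natDegree_mul hX hne, natDegree_X_sub_C] at hQ
      omega)
    refine ⟨c + Finsupp.single x (monomial k (P.eval x / Q'.eval x)), ?_⟩
    have hP : P = (X - C x) * P₁ + C (P.eval x / Q'.eval x) * Q' := by rw [← hP₁]; ring
    have hX' : algebraMap ℂ[X] (RatFunc ℂ) (X - C x) ≠ 0 := RatFunc.algebraMap_ne_zero hX
    have hQ'' : algebraMap ℂ[X] (RatFunc ℂ) Q' ≠ 0 := by simpa using hQ'0
    rw [map_add, hc, partialFraction_single_monomial]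
    conv_rhs => rw [hP, hQ']
    rw [← RatFunc.algebraMap_X, ← RatFunc.algebraMap_C, ← RatFunc.algebraMap_C, ← map_sub]
    simp only [map_add, map_mul, map_pow]
    generalize algebraMap ℂ[X] (RatFunc ℂ) (X - C x) = u at *
    field_simp
    ring

/-- Every proper rational function is the rational function of a signal, whose order is at most
the degree of the denominator. -/
theorem Signal.exists_ratFunc_eq {P Q : ℂ[X]} (h : P.degree < Q.degree) :
    ∃ F : Signal, F.order ≤ Q.natDegree ∧
      F.ratFunc = algebraMap ℂ[X] (RatFunc ℂ) P / algebraMap ℂ[X] (RatFunc ℂ) Q := by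
  obtain ⟨c, hc⟩ := exists_partialFraction_eq _ P Q h rfl
  rw [← Signal.toFinsupp_ofFinsupp c, Signal.partialFraction_toFinsupp] at hc
  refine ⟨_, ?_, hc⟩
  -- The order is the degree of the reduced denominator, which divides `Q`.
  rw [← natDegree_den, ← denom_ratFunc, hc]
  exact natDegree_le_of_dvd (RatFunc.denom_div_dvd _ _) (by rintro rfl; simp at h)

theorem Signal.isPadeSolution {d : ℕ} {m : Fin (2 * d) → ℂ} {F : Signal}
    (hF : IsPronySolution m F) : IsPadeSolution m F.ratFunc :=
  ⟨⟨F.num, F.den, F.degree_num_lt, F.natDegree_den.trans_le hF.1, F.ratFunc_eq⟩, fun k => by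
    rw [expansionAtInfty_eq, F.coeff_expansion_ratFunc, hF.2 k]⟩

end Prony

/-! ### Hankel matrix: rank, leading minors and recurrences -/

namespace Prony

open Polynomial Matrix

variable {d : ℕ} (m : Fin (2 * d) → ℂ)

theorem hankelMatrix_apply (i : Fin d) (j : Fin (d + 1)) :
    hankelMatrix m i j = m ⟨(i : ℕ) + (j : ℕ), by omega⟩ := rfl

/-- The leading `e` rows and all columns of the Hankel matrix have rank at least the size of a
nonvanishing leading minor. -/
theorem le_rank_of_hankelMinor_ne_zero {e : ℕ} (he : e ≤ d) (h : hankelMinor m e he ≠ 0) :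
    e ≤ ((hankelMatrix m).submatrix (Fin.castLE he) id).rank := by
  have h1 := rank_of_det_ne_zero h
  rw [Fintype.card_fin] at h1
  exact h1.symm.le.trans (((hankelMatrix m).submatrix (Fin.castLE he) id).rank_submatrix_le id
    (Fin.castLE (he.trans d.le_succ)))

/-- If the leading minor whose size is the rank does not vanish, the leading rows determine the
kernel of the Hankel matrix. -/
theorem hankelMatrix_mulVec_eq_zero
    (h : hankelMinor m (hankelMatrix m).rank (hankelMatrix_rank_le m) ≠ 0) {v : Fin (d + 1) → ℂ}
    (hv : ∀ i : Fin d, (i : ℕ) < (hankelMatrix m).rank → (hankelMatrix m *ᵥ v) i = 0) :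
    hankelMatrix m *ᵥ v = 0 := by
  set M := hankelMatrix m with hM
  set M' := M.submatrix (Fin.castLE (hankelMatrix_rank_le m)) id with hM'
  have h1 : M.rank ≤ M'.rank := le_rank_of_hankelMinor_ne_zero m (hankelMatrix_rank_le m) h
  have hle : LinearMap.ker M.mulVecLin ≤ LinearMap.ker M'.mulVecLin := by
    intro w hw
    rw [LinearMap.mem_ker, mulVecLin_apply] at hw ⊢
    ext i
    exact congrFun hw (Fin.castLE (hankelMatrix_rank_le m) i)
  have e1 := LinearMap.finrank_range_add_finrank_ker M.mulVecLin
  have e2 := LinearMap.finrank_range_add_finrank_ker M'.mulVecLin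
  -- By rank-nullity, `ker M'` is no larger in dimension than `ker M`, which it contains.
  have heq := Submodule.eq_of_le_of_finrank_le hle (by
    change Module.finrank ℂ (LinearMap.range M.mulVecLin) ≤
      Module.finrank ℂ (LinearMap.range M'.mulVecLin) at h1
    omega)
  have hv' : v ∈ LinearMap.ker M'.mulVecLin := by
    rw [LinearMap.mem_ker, mulVecLin_apply]
    ext i
    exact hv (Fin.castLE (hankelMatrix_rank_le m) i) i.2
  rw [← heq, LinearMap.mem_ker, mulVecLin_apply] at hv'
  exact hv'

/-- The series `∑_k m_k w ^ (k + 1)`. -/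
noncomputable def momentSeries : LaurentSeries ℂ :=
  ∑ k : Fin (2 * d), HahnSeries.single ((k : ℤ) + 1) (m k)

theorem coeff_momentSeries (k : Fin (2 * d)) : (momentSeries m).coeff ((k : ℤ) + 1) = m k := by
  rw [momentSeries, HahnSeries.coeff_sum, Finset.sum_eq_single k]
  · simp
  · intro i _ hi
    rw [HahnSeries.coeff_single, if_neg]
    intro h
    exact hi (Fin.ext (by omega))
  · simp

theorem coeff_momentSeries_of_le {e : ℤ} (he : e ≤ 0) : (momentSeries m).coeff e = 0 := by
  rw [momentSeries, HahnSeries.coeff_sum]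
  refine Finset.sum_eq_zero fun k _ => ?_
  rw [HahnSeries.coeff_single, if_neg (by omega)]

variable {m}

/-- The Hankel matrix acts on coefficient vectors as multiplication by a series with the given
moments. -/
theorem hankelMatrix_mulVec_coeff {f : LaurentSeries ℂ}
    (hf : ∀ k : Fin (2 * d), f.coeff ((k : ℤ) + 1) = m k) {V : ℂ[X]} (hV : V.natDegree < d + 1)
    (i : Fin d) :
    (hankelMatrix m *ᵥ fun j : Fin (d + 1) => V.coeff j) i =
      (polyExpansion V * f).coeff ((i : ℤ) + 1) := by
  rw [coeff_polyExpansion_mul V hV, mulVec, dotProduct, Finset.sum_range]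
  refine Finset.sum_congr rfl fun j _ => ?_
  have := hf ⟨(i : ℕ) + j, by omega⟩
  rw [mul_comm, hankelMatrix_apply, ← this]
  congr 2
  push_cast
  ring

/-- A monic polynomial of degree at most `d` annihilating the moment sequence bounds the rank of
the Hankel matrix. -/
theorem hankelMatrix_rank_le_natDegree {f : LaurentSeries ℂ}
    (hf : ∀ k : Fin (2 * d), f.coeff ((k : ℤ) + 1) = m k) {Q : ℂ[X]} (hQ : Q.Monic)
    (hQf : ∀ e : ℤ, 0 < e → (polyExpansion Q * f).coeff e = 0) :
    (hankelMatrix m).rank ≤ Q.natDegree := by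
  have hcol : ∀ t (ht : t < d + 1), (hankelMatrix m).col ⟨t, ht⟩ ∈
      Submodule.span ℂ (Set.range fun j : Fin (min Q.natDegree (d + 1)) =>
        (hankelMatrix m).col ⟨j, by omega⟩) := by
    intro t
    induction t using Nat.strong_induction_on with
    | _ t ih =>
      intro ht
      rcases lt_or_ge t Q.natDegree with h | h
      · exact Submodule.subset_span ⟨⟨t, by omega⟩, rfl⟩
      obtain ⟨u, rfl⟩ := Nat.exists_eq_add_of_le h
      -- The recurrence expresses each column through the `deg Q` preceding ones.
      have hrec : (hankelMatrix m).col ⟨Q.natDegree + u, ht⟩ =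
          -∑ j : Fin Q.natDegree, Q.coeff j • (hankelMatrix m).col ⟨j + u, by omega⟩ := by
        ext i
        rw [Pi.neg_apply, eq_neg_iff_add_eq_zero, add_comm]
        have := hQf ((i + u : ℕ) + 1) (by omega)
        rw [coeff_polyExpansion_mul Q (Nat.lt_succ_self _), Finset.sum_range_succ,
          Finset.sum_range, hQ.coeff_natDegree, one_mul] at this
        rw [← this, Finset.sum_apply]
        congr 1
        · refine Finset.sum_congr rfl fun j _ => ?_
          rw [Pi.smul_apply, smul_eq_mul, col_apply, hankelMatrix_apply, ← hf]
          congr 2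
          push_cast
          ring
        · rw [col_apply, hankelMatrix_apply, ← hf]
          congr 1
          push_cast
          ring
      rw [hrec]
      refine Submodule.neg_mem _ (Submodule.sum_mem _ fun j _ => Submodule.smul_mem _ _ ?_)
      exact ih _ (by omega) _
  rw [rank_eq_finrank_span_cols]
  calc Module.finrank ℂ (Submodule.span ℂ (Set.range (hankelMatrix m).col))
      ≤ (Set.range fun j : Fin (min Q.natDegree (d + 1)) =>
        (hankelMatrix m).col ⟨j, by omega⟩).finrank ℂ :=
        Submodule.finrank_mono (Submodule.span_le.2 (by rintro _ ⟨j, rfl⟩; exact hcol j j.2))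
    _ ≤ min Q.natDegree (d + 1) := (finrank_range_le_card _).trans_eq (Fintype.card_fin _)
    _ ≤ Q.natDegree := min_le_left _ _

/-- The leading minor of size the degree of the reduced denominator does not vanish. -/
theorem hankelMinor_ne_zero_of_isCoprime {f : LaurentSeries ℂ}
    (hf : ∀ k : Fin (2 * d), f.coeff ((k : ℤ) + 1) = m k) {P Q : ℂ[X]}
    (hPQ : IsCoprime P Q) (hQf : polyExpansion Q * f = polyExpansion P)
    (hd : Q.natDegree ≤ d) : hankelMinor m Q.natDegree hd ≠ 0 := by
  set n := Q.natDegree with hn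
  intro hdet
  obtain ⟨v, hv0, hv⟩ := exists_mulVec_eq_zero_iff.2 hdet
  set V : ℂ[X] := ∑ j : Fin n, monomial (j : ℕ) (v j) with hVdef
  have hVc : ∀ j : Fin n, V.coeff j = v j := fun j => by
    rw [hVdef, finsetSum_coeff, Finset.sum_eq_single j]
    · simp
    · intro i _ hi
      rw [coeff_monomial, if_neg fun h => hi (Fin.ext h)]
    · simp
  have hVdeg : V.degree < n := by
    refine (degree_sum_le _ _).trans_lt
      ((Finset.sup_lt_iff (WithBot.bot_lt_coe _)).2 fun j _ => ?_)
    exact (degree_monomial_le _ _).trans_lt (by exact_mod_cast j.2)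
  have hV0 : V ≠ 0 := by
    rintro h
    refine hv0 (funext fun j => ?_)
    rw [← hVc, h, coeff_zero, Pi.zero_apply]
  have hVn : V.natDegree < n := (natDegree_lt_iff_degree_lt hV0).2 hVdeg
  have hzero : ∀ i : ℕ, i < n → (polyExpansion V * f).coeff ((i : ℤ) + 1) = 0 := by
    intro i hi
    have := congrFun hv ⟨i, hi⟩
    rw [mulVec, dotProduct, Pi.zero_apply] at this
    rw [coeff_polyExpansion_mul V hVn, Finset.sum_range, ← this]
    refine Finset.sum_congr rfl fun j _ => ?_
    rw [hVc, mul_comm, submatrix_apply, hankelMatrix_apply, ← hf]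
    congr 2
    simp only [Fin.val_castLE]
    push_cast
    ring
  -- the polynomial part of `V * f`
  set N := ((polyExpansion V * f).order).natAbs with hN
  set T : ℂ[X] := ∑ k ∈ Finset.range (N + 1),
    monomial k ((polyExpansion V * f).coeff (-(k : ℤ))) with hT
  have hTc : ∀ k : ℕ, T.coeff k = (polyExpansion V * f).coeff (-(k : ℤ)) := by
    intro k
    rw [hT, finsetSum_coeff]
    simp only [coeff_monomial, Finset.sum_ite_eq', Finset.mem_range]
    split_ifs with h
    · rfl
    · rw [HahnSeries.coeff_eq_zero_of_lt_order]
      omega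
  -- Nonpositive exponents are cancelled by `T`; exponents `1, …, n` vanish by the kernel equations.
  -- Multiplication by `Q`, of degree `n`, then still leaves only positive exponents.
  have hg : ∀ e < (n : ℤ) + 1, (polyExpansion V * f - polyExpansion T).coeff e = 0 := by
    intro e he
    rw [HahnSeries.coeff_sub, coeff_polyExpansion]
    split_ifs with h0
    · rw [hTc, Int.toNat_of_nonneg (by omega), neg_neg, sub_self]
    · obtain ⟨i, rfl⟩ : ∃ i : ℕ, e = (i : ℤ) + 1 := ⟨(e - 1).toNat, by omega⟩
      rw [hzero i (by omega), sub_zero]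
  have heq : V * P - T * Q = 0 := by
    apply eq_zero_of_coeff_polyExpansion
    intro e he
    have : polyExpansion (V * P - T * Q) =
        polyExpansion Q * (polyExpansion V * f - polyExpansion T) := by
      rw [map_sub, map_mul, map_mul, ← hQf]
      ring
    rw [this]
    exact coeff_polyExpansion_mul_eq_zero hg Q (by omega)
  have hdvd : Q ∣ V := hPQ.symm.dvd_of_dvd_mul_right ⟨T, by rw [sub_eq_zero.1 heq, mul_comm]⟩
  exact absurd (natDegree_le_of_dvd hdvd hV0) (by omega)

/-- If the leading minor whose size is the rank does not vanish, the moment sequence satisfies a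
linear recurrence whose order is the rank. -/
theorem exists_monic_of_hankelMinor_ne_zero
    (h : hankelMinor m (hankelMatrix m).rank (hankelMatrix_rank_le m) ≠ 0) :
    ∃ Q : ℂ[X], Q.Monic ∧ Q.natDegree = (hankelMatrix m).rank ∧
      ∀ e : ℤ, 0 < e → e ≤ 2 * d - Q.natDegree →
        (polyExpansion Q * momentSeries m).coeff e = 0 := by
  have hrd := hankelMatrix_rank_le m
  set r := (hankelMatrix m).rank with hr
  -- The lower coefficients of `Q` solve the `r × r` system whose right-hand side is minus the next
  -- column.
  obtain ⟨q, hq⟩ := (mulVec_surjective_iff_isUnit.2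
    ((isUnit_iff_isUnit_det _).2 (isUnit_iff_ne_zero.2 h)))
    fun i : Fin r => -m ⟨i + r, by omega⟩
  set q' : ℂ[X] := ∑ j : Fin r, monomial (j : ℕ) (q j) with hq'
  have hqc : ∀ j : Fin r, q'.coeff j = q j := fun j => by
    rw [hq', finsetSum_coeff, Finset.sum_eq_single j]
    · simp
    · intro i _ hi
      rw [coeff_monomial, if_neg fun h => hi (Fin.ext h)]
    · simp
  have hqdeg : q'.degree < r := by
    refine (degree_sum_le _ _).trans_lt
      ((Finset.sup_lt_iff (WithBot.bot_lt_coe _)).2 fun j _ => ?_)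
    exact (degree_monomial_le _ _).trans_lt (by exact_mod_cast j.2)
  set Q := X ^ r + q' with hQ
  have hmonic : Q.Monic := monic_X_pow_add hqdeg
  have hdeg : Q.natDegree = r := natDegree_eq_of_degree_eq_some (by
    rw [hQ, degree_add_eq_left_of_degree_lt (by rwa [degree_X_pow]), degree_X_pow])
  have hcoeff : ∀ t i : ℕ, (polyExpansion (X ^ t * Q) * momentSeries m).coeff ((i : ℤ) + 1) =
      (polyExpansion Q * momentSeries m).coeff (((i + t : ℕ) : ℤ) + 1) := by
    intro t i
    have hX : polyExpansion (X ^ t) = HahnSeries.single (-(t : ℤ)) 1 := by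
      simp [polyExpansion, HahnSeries.single_pow]
    rw [map_mul, hX, mul_assoc, HahnSeries.coeff_single_mul, one_mul]
    congr 1
    push_cast
    ring
  have hfirst : ∀ i : ℕ, i < r → (polyExpansion Q * momentSeries m).coeff ((i : ℤ) + 1) = 0 := by
    intro i hi
    have := congrFun hq ⟨i, hi⟩
    rw [coeff_polyExpansion_mul Q (n := r + 1) (by omega), Finset.sum_range_succ, Finset.sum_range,
      ← hdeg, hmonic.coeff_natDegree, hdeg, one_mul]
    have e1 : (momentSeries m).coeff ((i : ℤ) + 1 + r) = m ⟨i + r, by omega⟩ := by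
      rw [← coeff_momentSeries m]
      congr 1
      push_cast
      ring
    rw [e1, ← eq_neg_iff_add_eq_zero, ← this, mulVec, dotProduct]
    refine Finset.sum_congr rfl fun j _ => ?_
    rw [hQ, coeff_add, coeff_X_pow, if_neg (by omega), zero_add, hqc, mul_comm, submatrix_apply,
      hankelMatrix_apply, ← coeff_momentSeries m]
    congr 2
    simp only [Fin.val_castLE]
    push_cast
    ring
  -- The coefficient vector of `X ^ t * Q` fits in `d + 1` entries, so vanishing on the leading `r`
  -- rows forces vanishing on all `d`.
  have hshift : ∀ t : ℕ, t + r ≤ d →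
      (∀ i : ℕ, i < r → (polyExpansion Q * momentSeries m).coeff (((i + t : ℕ) : ℤ) + 1) = 0) →
      ∀ i : ℕ, i < d → (polyExpansion Q * momentSeries m).coeff (((i + t : ℕ) : ℤ) + 1) = 0 := by
    intro t ht hrow i hi
    have hn : (X ^ t * Q).natDegree < d + 1 := by
      rw [natDegree_mul (pow_ne_zero _ X_ne_zero) hmonic.ne_zero, natDegree_X_pow]
      omega
    have hker := hankelMatrix_mulVec_eq_zero m h (v := fun j => (X ^ t * Q).coeff j) fun i hi => by
      rw [hankelMatrix_mulVec_coeff (coeff_momentSeries m) hn, hcoeff]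
      exact hrow i hi
    rw [← hcoeff, ← hankelMatrix_mulVec_coeff (coeff_momentSeries m) hn ⟨i, hi⟩, hker, Pi.zero_apply]
  refine ⟨Q, hmonic, hdeg, fun e he0 he => ?_⟩
  rw [hdeg] at he
  have h0 : ∀ i : ℕ, i < d → (polyExpansion Q * momentSeries m).coeff ((i : ℤ) + 1) = 0 :=
    hshift 0 (by omega) hfirst
  obtain ⟨k, rfl⟩ : ∃ k : ℕ, e = (k : ℤ) + 1 := ⟨(e - 1).toNat, by omega⟩
  rcases lt_or_ge k d with hk | hk
  · exact h0 k hk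
  -- The largest admissible shift has its first `r` rows at indices below `d`, already covered by
  -- `h0`; it reaches index `2d - r - 1`.
  · have := hshift (d - r) (by omega) (fun i hi => h0 _ (by omega)) (k - (d - r)) (by omega)
    rwa [show k - (d - r) + (d - r) = k by omega] at this

/-- A linear recurrence of order at most `d` yields a solution of the Padé problem. -/
theorem exists_div_of_recurrence {Q : ℂ[X]} (hQ : Q.Monic)
    (hrec : ∀ e : ℤ, 0 < e → e ≤ 2 * d - Q.natDegree →
      (polyExpansion Q * momentSeries m).coeff e = 0) :
    ∃ P : ℂ[X], P.degree < Q.degree ∧ ∀ k : Fin (2 * d),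
      (expansion (algebraMap ℂ[X] (RatFunc ℂ) P / algebraMap ℂ[X] (RatFunc ℂ) Q)).coeff
        ((k : ℤ) + 1) = m k := by
  set n := Q.natDegree with hn
  set f := momentSeries m with hf
  set P : ℂ[X] := ∑ k ∈ Finset.range n,
    monomial k ((polyExpansion Q * f).coeff (-(k : ℤ))) with hP
  have hPdeg : P.degree < Q.degree := by
    rw [degree_eq_natDegree hQ.ne_zero]
    refine (degree_sum_le _ _).trans_lt
      ((Finset.sup_lt_iff (WithBot.bot_lt_coe _)).2 fun j hj => ?_)
    exact (degree_monomial_le _ _).trans_lt (by exact_mod_cast Finset.mem_range.1 hj)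
  have hPc : ∀ k : ℕ, P.coeff k = (polyExpansion Q * f).coeff (-(k : ℤ)) := by
    intro k
    rw [hP, finsetSum_coeff]
    simp only [coeff_monomial, Finset.sum_ite_eq', Finset.mem_range]
    split_ifs with h
    · rfl
    -- The moment series starts at `w`, so the polynomial part of its product with `Q` has degree
    -- below `n`.
    · rw [coeff_polyExpansion_mul_eq_zero (N := 1)
        (fun e he => coeff_momentSeries_of_le m (by omega))]
      omega
  refine ⟨P, hPdeg, fun k => ?_⟩
  have hk := k.2
  rw [← coeff_momentSeries m k, ← sub_eq_zero, ← HahnSeries.coeff_sub]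
  -- After multiplication by `Q` the difference vanishes through exponent `2d - n`; cancelling `Q`
  -- recovers the missing `n`.
  refine coeff_eq_zero_of_polyExpansion_mul hQ.ne_zero (N := 2 * d - n + 1) (fun e he => ?_)
    (by omega)
  rw [mul_sub, polyExpansion_mul_expansion_div P hQ.ne_zero, HahnSeries.coeff_sub,
    coeff_polyExpansion]
  split_ifs with h0
  · rw [hPc, Int.toNat_of_nonneg (by omega), neg_neg, sub_self]
  · rw [hrec e (by omega) (by omega), sub_zero]

/-- The nonzero minor bounds the rank from below by the order; the recurrence from `den` bounds it
from above. -/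
theorem IsPronySolution.rank_eq {F : Signal} (hF : IsPronySolution m F) :
    F.order = (hankelMatrix m).rank ∧ hankelMinor m F.order hF.1 ≠ 0 := by
  have hf : ∀ k : Fin (2 * d), (expansion F.ratFunc).coeff ((k : ℤ) + 1) = m k := fun k => by
    rw [F.coeff_expansion_ratFunc, hF.2 k]
  have hQf : polyExpansion F.den * expansion F.ratFunc = polyExpansion F.num := by
    rw [F.ratFunc_eq, polyExpansion_mul_expansion_div _ F.den_monic.ne_zero]
  have hminor := hankelMinor_ne_zero_of_isCoprime hf F.isCoprime_num_den hQf
    (F.natDegree_den.trans_le hF.1)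
  have hrank := hankelMatrix_rank_le_natDegree hf F.den_monic fun e he => by
    rw [hQf, coeff_polyExpansion, if_neg (by omega)]
  simp only [F.natDegree_den] at hminor hrank
  exact ⟨((le_rank_of_hankelMinor_ne_zero m hF.1 hminor).trans
    ((hankelMatrix m).rank_submatrix_le _ _)).antisymm hrank, hminor⟩

theorem exists_isPronySolution
    (h : hankelMinor m (hankelMatrix m).rank (hankelMatrix_rank_le m) ≠ 0) :
    ∃ F : Signal, IsPronySolution m F := by
  obtain ⟨Q, hQ, hdeg, hrec⟩ := exists_monic_of_hankelMinor_ne_zero h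
  obtain ⟨P, hPQ, hP⟩ := exists_div_of_recurrence hQ hrec
  obtain ⟨F, hF, hFR⟩ := Signal.exists_ratFunc_eq hPQ
  refine ⟨F, hF.trans (hdeg.trans_le (hankelMatrix_rank_le m)), fun k => ?_⟩
  rw [← F.coeff_expansion_ratFunc, hFR, hP]

end Prony

theorem mainTheorem1 (d : ℕ) (m : Fin (2 * d) → ℂ) :
    -- solvability
    ((∃ F : Prony.Signal, Prony.IsPronySolution m F) ↔
      Prony.hankelMinor m (Prony.hankelMatrix m).rank (Prony.hankelMatrix_rank_le m) ≠ 0) ∧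
    -- uniqueness up to a permutation of the nodes
    (∀ F G : Prony.Signal, Prony.IsPronySolution m F → Prony.IsPronySolution m G →
      F.EqUpToPerm G) ∧
    -- the multiplicity vector
    (∀ F : Prony.Signal, Prony.IsPronySolution m F →
      F.order = (Prony.hankelMatrix m).rank ∧
      (∀ R : RatFunc ℂ, Prony.IsPadeSolution m R ↔ R = F.ratFunc) ∧
      (∀ z : ℂ, 0 < Prony.poleMultiplicity F.ratFunc z ↔ ∃ j, F.node j = z) ∧
      (∀ j, Prony.poleMultiplicity F.ratFunc (F.node j) = F.mult j)) := by
  refine ⟨⟨fun ⟨F, hF⟩ => ?_, Prony.exists_isPronySolution⟩, fun F G hF hG => ?_, fun F hF =>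
    ⟨hF.rank_eq.1, fun R => ⟨fun hR => ?_, fun hR => ?_⟩, F.poleMultiplicity_pos_iff,
      F.poleMultiplicity_node⟩⟩
  · obtain ⟨hr, hminor⟩ := hF.rank_eq
    simpa only [hr] using hminor
  · exact .of_ratFunc_eq ((Prony.Signal.isPadeSolution hF).unique (Prony.Signal.isPadeSolution hG))
  · exact hR.unique (Prony.Signal.isPadeSolution hF)
  · exact hR ▸ Prony.Signal.isPadeSolution hF
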